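/- For $n\ge 1$ let $N_n$ be the number of connected noncrossing graphs on $n$ vertices, that is, the number of connected simple graphs on the vertex set $\{1,\dots,n\}$ such that, when the vertices are placed on a circle in this cyclic order and the edges are drawn as chords, no two edges cross; equivalently, there are no vertices $a<b<c<d$ for which both $\{a,c\}$ and $\{b,d\}$ are edges. Let $F=\sum_{m=0}^{\infty}x^{3^m}\in\mathbb{Z}[[x]]$. Then, coefficientwise, \[ \sum_{n=1}^{\infty} N_n x^n \equiv F+F^2 \pmod 3 . \] Moreover, for every $n\ge 1$, \[ N_n\equiv \begin{cases} 1 \pmod 3, & \text{if } n=3^k \text{ or } n=2\cdot 3^k \text{ for some integer } k\ge 0,\\ 2 \pmod 3, & \text{if } n=3^i+3^j \text{ for some integers } i,j\ge 0 \text{ with } i\ne j,\\ 0 \pmod 3, & \text{otherwise.} \end{cases} \] -/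

import Mathlib

/-- Place the vertices `0, 1, …, n - 1` in this cyclic order on a circle and draw edges as chords.
Two chords cross in their interiors exactly when their four endpoints are distinct and alternate
around the circle; a graph is noncrossing if no two of its edges cross. -/
def IsNoncrossing {n : ℕ} (G : SimpleGraph (Fin n)) : Prop :=
  ∀ a b c d : Fin n, a < b → b < c → c < d → ¬ (G.Adj a c ∧ G.Adj b d)

/-- The number of connected noncrossing graphs on `n` (labelled) vertices. -/
noncomputable def numConnNoncrossing (n : ℕ) : ℕ :=
  Nat.card {G : SimpleGraph (Fin n) // G.Connected ∧ IsNoncrossing G}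

/-- The generating function `∑_{n ≥ 1} N_n x ^ n`. -/
noncomputable def connNoncrossingSeries : PowerSeries ℤ :=
  PowerSeries.mk fun n => if 1 ≤ n then (numConnNoncrossing n : ℤ) else 0

open Classical in
/-- The power series `F = ∑_{m ≥ 0} x ^ (3 ^ m)`. -/
noncomputable def powThreeSeries : PowerSeries ℤ :=
  PowerSeries.mk fun n => if ∃ m : ℕ, n = 3 ^ m then 1 else 0

/-- Coefficientwise congruence of integer power series modulo `k`. -/
def PowerSeriesModEq (k : ℤ) (A B : PowerSeries ℤ) : Prop :=
  ∀ n : ℕ, PowerSeries.coeff n A ≡ PowerSeries.coeff n B [ZMOD k]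

/-! Two decompositions on the vertices `0, …, n` give a cubic equation for the generating function
`C`. Let `D = C / x`, and let `A` count the connected noncrossing graphs containing the outer edge
`0n`. Cutting at the largest neighbour of `0` gives `D = 1 + A * D`
(`ncard_connNoncrossingOn_eq_sum`). Deleting the outer edge leaves either a connected graph without
that edge or two connected graphs on complementary segments, so `2 * A = D - 1 + x * D ^ 2`
(`ncard_closed_eq_add`, `ncard_bridgedConnNoncrossingOn`). Eliminating `A` yields `C ^ 3 + C ^ 2 - 3
* x * C + 2 * x ^ 2 = 0`.

Modulo 3 this reads `C ^ 3 + C ^ 2 = x ^ 2`. Frobenius gives `F ^ 3 = F - x`, from which `F + F ^ 2`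
satisfies the same equation; the solution with zero constant term and linear coefficient 1 is
unique. The residues are then the coefficients of `F` and `F ^ 2`, whose supports are disjoint by
parity. -/

namespace SimpleGraph

/-- Reachability is the smallest predicate containing the base vertex and closed under adjacency. -/
theorem reachable_iff_forall_closed {V : Type*} {G : SimpleGraph V} {u v : V} :
    G.Reachable u v ↔ ∀ P : V → Prop, P u → (∀ i j, G.Adj i j → P i → P j) → P v := by
  constructor
  · rintro ⟨w⟩ P hu hP
    induction w with
    | nil => exact hu
    | cons h _ ih => exact ih (hP _ _ h hu)
  · intro h
    exact h (G.Reachable u) (Reachable.refl u) fun i j hij hi => hi.trans hij.reachable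

end SimpleGraph

open SimpleGraph

/-! ### Connected noncrossing graphs on intervals -/

/-- The noncrossing graphs on `ℕ` whose edges have both ends in `[l, r]` and which connect all
vertices of `[l, r]`. Connectedness is expressed by closure of predicates under adjacency. -/
def connNoncrossingOn (l r : ℕ) : Set (SimpleGraph ℕ) :=
  {G | (∀ i j, G.Adj i j → l ≤ i ∧ i ≤ r) ∧
    (∀ a b c d, a < b → b < c → c < d → ¬ (G.Adj a c ∧ G.Adj b d)) ∧
    ∀ P : ℕ → Prop, P l → (∀ i j, G.Adj i j → P i → P j) → ∀ i, l ≤ i → i ≤ r → P i}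

/-- The members of `connNoncrossingOn l r` that contain the edge joining `l` and `r`. -/
def closedConnNoncrossingOn (l r : ℕ) : Set (SimpleGraph ℕ) :=
  {G | G ∈ connNoncrossingOn l r ∧ G.Adj l r}

/-- The graph formed by the edges of `G` with both ends in `[l, r]`. -/
def SimpleGraph.onInterval (G : SimpleGraph ℕ) (l r : ℕ) : SimpleGraph ℕ where
  Adj i j := G.Adj i j ∧ (l ≤ i ∧ i ≤ r) ∧ (l ≤ j ∧ j ≤ r)
  symm := ⟨fun _ _ h => ⟨h.1.symm, h.2.2, h.2.1⟩⟩
  loopless := ⟨fun i h => G.loopless.irrefl i h.1⟩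

theorem SimpleGraph.onInterval_adj {G : SimpleGraph ℕ} {l r i j : ℕ} :
    (G.onInterval l r).Adj i j ↔ G.Adj i j ∧ (l ≤ i ∧ i ≤ r) ∧ (l ≤ j ∧ j ≤ r) := Iff.rfl

/-- The embedding of `{0, …, n - 1}` onto `{l, …, l + n - 1}`. -/
def Fin.addEmbedding (l n : ℕ) : Fin n ↪ ℕ :=
  ⟨fun i => l + i, fun i j h => Fin.ext (by simpa using h)⟩

/-- Intervals of `ℕ` let pieces be cut and glued without relabelling; this transfer shows that their
counts depend only on the length. -/
theorem connNoncrossingOn_eq_image (l n : ℕ) :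
    connNoncrossingOn l (l + n) = (fun G => G.map (Fin.addEmbedding l (n + 1))) ''
      {G : SimpleGraph (Fin (n + 1)) | G.Connected ∧ IsNoncrossing G} := by
  have hval : ∀ i : Fin (n + 1), Fin.addEmbedding l (n + 1) i = l + i := fun _ => rfl
  have hsurj : ∀ i, l ≤ i → i ≤ l + n → ∃ k, Fin.addEmbedding l (n + 1) k = i := fun i h1 h2 =>
    ⟨⟨i - l, by omega⟩, by rw [hval]; simp; omega⟩
  ext G
  constructor
  · rintro ⟨hs, hn, hc⟩
    refine ⟨G.comap (Fin.addEmbedding l (n + 1)), ⟨?_, ?_⟩, ?_⟩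
    · rw [connected_iff_exists_forall_reachable]
      refine ⟨0, fun v => reachable_iff_forall_closed.2 fun P h0 hP => ?_⟩
      have := hc (fun x => ∀ u, Fin.addEmbedding l (n + 1) u = x → P u) ?_ ?_ (l + v) (by omega)
        (by omega)
      · exact this v rfl
      · intro u hu
        rw [hval] at hu
        have : u = 0 := Fin.ext (by simpa using hu)
        rwa [this]
      · intro i j hij hi u hu
        obtain ⟨k, rfl⟩ := hsurj i (hs i j hij).1 (hs i j hij).2
        exact hP k u (by rw [comap_adj, hu]; exact hij) (hi k rfl)
    · intro a b c d hab hbc hcd h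
      refine hn (l + a) (l + b) (l + c) (l + d) ?_ ?_ ?_ h <;> simpa
    · ext i j
      simp only [map_adj, comap_adj]
      constructor
      · rintro ⟨u, v, h, rfl, rfl⟩
        exact h
      · intro h
        obtain ⟨u, rfl⟩ := hsurj i (hs i j h).1 (hs i j h).2
        obtain ⟨v, rfl⟩ := hsurj j (hs j _ h.symm).1 (hs j _ h.symm).2
        exact ⟨u, v, h, rfl, rfl⟩
  · rintro ⟨G, ⟨hc, hn⟩, rfl⟩
    refine ⟨?_, ?_, ?_⟩
    · intro i j hij
      rw [map_adj] at hij
      obtain ⟨u, v, -, rfl, -⟩ := hij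
      rw [hval]
      omega
    · rintro a b c d hab hbc hcd ⟨h1, h2⟩
      rw [map_adj] at h1 h2
      obtain ⟨a, c, h1, rfl, rfl⟩ := h1
      obtain ⟨b, d, h2, rfl, rfl⟩ := h2
      simp only [hval] at hab hbc hcd
      exact hn a b c d (by omega) (by omega) (by omega) ⟨h1, h2⟩
    · intro P h0 hP i h1 h2
      obtain ⟨k, rfl⟩ := hsurj i h1 h2
      refine reachable_iff_forall_closed.1 (hc.preconnected 0 k)
        (fun u => P (Fin.addEmbedding l (n + 1) u)) (by simpa [hval] using h0) ?_
      intro i j hij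
      exact hP _ _ (map_adj_apply.2 hij)

theorem ncard_connNoncrossingOn (l n : ℕ) :
    (connNoncrossingOn l (l + n)).ncard = numConnNoncrossing (n + 1) := by
  rw [connNoncrossingOn_eq_image, Set.ncard_image_of_injective _ (map_injective _)]
  rfl

theorem finite_connNoncrossingOn {l r : ℕ} (h : l ≤ r) : (connNoncrossingOn l r).Finite := by
  obtain ⟨n, rfl⟩ := Nat.exists_eq_add_of_le h
  rw [connNoncrossingOn_eq_image]
  exact (Set.toFinite _).image _

theorem finite_closedConnNoncrossingOn {l r : ℕ} (h : l ≤ r) :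
    (closedConnNoncrossingOn l r).Finite :=
  (finite_connNoncrossingOn h).subset fun _ hG => hG.1

/-! ### Cutting and gluing at a vertex -/

/-- If every element of `S` is uniquely of the form `g a b` with `i ∈ I`, `a ∈ A i`, `b ∈ B i`,
then `S` is counted by the pairs in the products `A i × B i`. -/
theorem Set.ncard_eq_sum_ncard_mul_ncard {ι α β γ : Type*} {I : Finset ι} {A : ι → Set α}
    {B : ι → Set β} {S : Set γ} (g : α → β → γ)
    (hA : ∀ i ∈ I, (A i).Finite) (hB : ∀ i ∈ I, (B i).Finite)
    (hmem : ∀ i ∈ I, ∀ a ∈ A i, ∀ b ∈ B i, g a b ∈ S)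
    (hsurj : ∀ s ∈ S, ∃ i ∈ I, ∃ a ∈ A i, ∃ b ∈ B i, g a b = s)
    (hinj : ∀ i ∈ I, ∀ j ∈ I, ∀ a ∈ A i, ∀ b ∈ B i, ∀ a' ∈ A j, ∀ b' ∈ B j,
      g a b = g a' b' → i = j ∧ a = a' ∧ b = b') :
    S.ncard = ∑ i ∈ I, (A i).ncard * (B i).ncard := by
  have hS : S = ⋃ i ∈ I, (fun p : α × β => g p.1 p.2) '' (A i ×ˢ B i) := by
    ext s
    simp only [Set.mem_iUnion, Set.mem_image, Set.mem_prod, Prod.exists]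
    constructor
    · intro hs
      obtain ⟨i, hi, a, ha, b, hb, rfl⟩ := hsurj s hs
      exact ⟨i, hi, a, b, ⟨ha, hb⟩, rfl⟩
    · rintro ⟨i, hi, a, b, ⟨ha, hb⟩, rfl⟩
      exact hmem i hi a ha b hb
  have hfin : ∀ i ∈ (I : Set ι), ((fun p : α × β => g p.1 p.2) '' (A i ×ˢ B i)).Finite :=
    fun i hi => ((hA i hi).prod (hB i hi)).image _
  rw [hS, ← finsum_mem_coe_finset]
  refine (I.finite_toSet.ncard_biUnion hfin ?_).trans (finsum_mem_congr rfl fun i hi => ?_)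
  · intro i hi j hj hij
    rw [Function.onFun, Set.disjoint_left]
    rintro _ ⟨p, hp, rfl⟩ ⟨q, hq, h⟩
    exact hij (hinj i hi j hj _ hp.1 _ hp.2 _ hq.1 _ hq.2 h.symm).1
  · rw [Set.InjOn.ncard_image, Set.ncard_prod]
    intro p hp q hq h
    have := hinj i hi i hi _ hp.1 _ hp.2 _ hq.1 _ hq.2 h
    exact Prod.ext this.2.1 this.2.2

theorem onInterval_sup_left {G H : SimpleGraph ℕ} {l m m' r : ℕ} (hm : m ≤ m')
    (hG : ∀ i j, G.Adj i j → l ≤ i ∧ i ≤ m) (hH : ∀ i j, H.Adj i j → m' ≤ i ∧ i ≤ r) :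
    (G ⊔ H).onInterval l m = G := by
  ext i j
  rw [onInterval_adj, sup_adj]
  constructor
  · rintro ⟨h | h, h1, h2⟩
    · exact h
    · have := h.ne
      have := hH _ _ h
      have := hH _ _ h.symm
      omega
  · intro h
    exact ⟨Or.inl h, hG _ _ h, hG _ _ h.symm⟩

theorem onInterval_sup_right {G H : SimpleGraph ℕ} {l m m' r : ℕ} (hm : m ≤ m')
    (hG : ∀ i j, G.Adj i j → l ≤ i ∧ i ≤ m) (hH : ∀ i j, H.Adj i j → m' ≤ i ∧ i ≤ r) :
    (G ⊔ H).onInterval m' r = H := by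
  ext i j
  rw [onInterval_adj, sup_adj]
  constructor
  · rintro ⟨h | h, h1, h2⟩
    · have := h.ne
      have := hG _ _ h
      have := hG _ _ h.symm
      omega
    · exact h
  · intro h
    exact ⟨Or.inr h, hH _ _ h, hH _ _ h.symm⟩

theorem noncrossing_sup {G H : SimpleGraph ℕ} {l m m' r : ℕ} (hm : m ≤ m')
    (hG : ∀ i j, G.Adj i j → l ≤ i ∧ i ≤ m) (hH : ∀ i j, H.Adj i j → m' ≤ i ∧ i ≤ r)
    (hGn : ∀ a b c d, a < b → b < c → c < d → ¬ (G.Adj a c ∧ G.Adj b d))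
    (hHn : ∀ a b c d, a < b → b < c → c < d → ¬ (H.Adj a c ∧ H.Adj b d)) :
    ∀ a b c d, a < b → b < c → c < d → ¬ ((G ⊔ H).Adj a c ∧ (G ⊔ H).Adj b d) := by
  rintro a b c d hab hbc hcd ⟨h1 | h1, h2 | h2⟩
  · exact hGn a b c d hab hbc hcd ⟨h1, h2⟩
  · have := hG _ _ h1.symm
    have := hH _ _ h2
    omega
  · have := hH _ _ h1
    have := hG _ _ h2.symm
    omega
  · exact hHn a b c d hab hbc hcd ⟨h1, h2⟩

/-- Gluing at a common vertex. -/
theorem sup_mem_connNoncrossingOn {G H : SimpleGraph ℕ} {l m r : ℕ} (hlm : l ≤ m) (hmr : m ≤ r)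
    (hG : G ∈ connNoncrossingOn l m) (hH : H ∈ connNoncrossingOn m r) :
    G ⊔ H ∈ connNoncrossingOn l r := by
  refine ⟨?_, noncrossing_sup le_rfl hG.1 hH.1 hG.2.1 hH.2.1, ?_⟩
  · rintro i j (h | h)
    · have := hG.1 _ _ h
      omega
    · have := hH.1 _ _ h
      omega
  · intro P hl hP i h1 h2
    have hleft := hG.2.2 P hl fun i j h => hP i j (Or.inl h)
    rcases le_total i m with him | him
    · exact hleft i h1 him
    · exact hH.2.2 P (hleft m hlm le_rfl) (fun i j h => hP i j (Or.inr h)) i him h2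

/-- No edge straddles `m`, so the retraction `x ↦ min x m` sends each edge to an edge of the left
piece or to a point. Connectedness follows by pulling predicates back along it; the right piece uses
`max`. -/
theorem onInterval_left_mem_connNoncrossingOn {G : SimpleGraph ℕ} {l m r : ℕ} (hlm : l ≤ m)
    (hmr : m ≤ r) (hG : G ∈ connNoncrossingOn l r)
    (hcut : ∀ i j, G.Adj i j → i < m → j ≤ m) :
    G.onInterval l m ∈ connNoncrossingOn l m := by
  refine ⟨fun i j h => h.2.1,
    fun a b c d hab hbc hcd h => hG.2.1 a b c d hab hbc hcd ⟨h.1.1, h.2.1⟩, ?_⟩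
  intro P hl hP i h1 h2
  have := hG.2.2 (fun x => P (min x m)) (by simpa [hlm] using hl) ?_ i h1 (h2.trans hmr)
  · simpa [h2] using this
  · intro i j hij hi
    have hl1 := hG.1 _ _ hij
    have hl2 := hG.1 _ _ hij.symm
    have h1 := hcut _ _ hij
    have h2 := hcut _ _ hij.symm
    by_cases him : i ≤ m ∧ j ≤ m
    · rw [min_eq_left him.1] at hi
      rw [min_eq_left him.2]
      exact hP i j ⟨hij, by omega, by omega⟩ hi
    · rw [min_eq_right (by omega)] at hi ⊢
      exact hi

theorem onInterval_right_mem_connNoncrossingOn {G : SimpleGraph ℕ} {l m r : ℕ} (hlm : l ≤ m)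
    (hG : G ∈ connNoncrossingOn l r) (hcut : ∀ i j, G.Adj i j → i < m → j ≤ m) :
    G.onInterval m r ∈ connNoncrossingOn m r := by
  refine ⟨fun i j h => h.2.1,
    fun a b c d hab hbc hcd h => hG.2.1 a b c d hab hbc hcd ⟨h.1.1, h.2.1⟩, ?_⟩
  intro P hl hP i h1 h2
  have := hG.2.2 (fun x => P (max x m)) (by simpa [hlm] using hl) ?_ i (hlm.trans h1) h2
  · simpa [h1] using this
  · intro i j hij hi
    have hl1 := hG.1 _ _ hij
    have hl2 := hG.1 _ _ hij.symm
    have h1 := hcut _ _ hij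
    have h2 := hcut _ _ hij.symm
    by_cases him : m ≤ i ∧ m ≤ j
    · rw [max_eq_left him.1] at hi
      rw [max_eq_left him.2]
      exact hP i j ⟨hij, by omega, by omega⟩ hi
    · rw [max_eq_right (by omega)] at hi ⊢
      exact hi

theorem onInterval_sup_onInterval {G : SimpleGraph ℕ} {l m r : ℕ}
    (hG : ∀ i j, G.Adj i j → l ≤ i ∧ i ≤ r) (hcut : ∀ i j, G.Adj i j → i < m → j ≤ m) :
    G.onInterval l m ⊔ G.onInterval m r = G := by
  ext i j
  rw [sup_adj, onInterval_adj, onInterval_adj]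
  constructor
  · rintro (h | h) <;> exact h.1
  · intro h
    have := hG _ _ h
    have := hG _ _ h.symm
    have := hcut _ _ h
    have := hcut _ _ h.symm
    by_cases him : i ≤ m ∧ j ≤ m
    · exact Or.inl ⟨h, by omega⟩
    · exact Or.inr ⟨h, by omega⟩

theorem exists_max_adj_zero {G : SimpleGraph ℕ} {n : ℕ} (hn : 1 ≤ n)
    (hG : G ∈ connNoncrossingOn 0 n) :
    ∃ v, 1 ≤ v ∧ v ≤ n ∧ G.Adj 0 v ∧ ∀ w, G.Adj 0 w → w ≤ v := by
  classical
  have hex : ∃ v, G.Adj 0 v := by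
    by_contra! h
    have := hG.2.2 (fun x => x = 0) rfl (fun i j hij hi => (h j (hi ▸ hij)).elim) n (by omega) le_rfl
    omega
  obtain ⟨w, hw⟩ := hex
  have hbd : ∀ w, G.Adj 0 w → w ≤ n := fun w hw => (hG.1 _ _ hw.symm).2
  have hspec := Nat.findGreatest_spec (P := fun v => G.Adj 0 v) (hbd w hw) hw
  refine ⟨_, ?_, Nat.findGreatest_le n, hspec, fun w hw => Nat.le_findGreatest (hbd w hw) hw⟩
  have := hspec.ne
  omega

/-- Splitting a connected noncrossing graph at the largest neighbour of its first vertex. -/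
theorem ncard_connNoncrossingOn_eq_sum {n : ℕ} (hn : 1 ≤ n) :
    (connNoncrossingOn 0 n).ncard = ∑ v ∈ Finset.Icc 1 n,
      (closedConnNoncrossingOn 0 v).ncard * (connNoncrossingOn v n).ncard := by
  refine Set.ncard_eq_sum_ncard_mul_ncard (fun G H => G ⊔ H) ?_ ?_ ?_ ?_ ?_
  · exact fun v _ => finite_closedConnNoncrossingOn (Nat.zero_le v)
  · exact fun v hv => finite_connNoncrossingOn (Finset.mem_Icc.1 hv).2
  · exact fun v hv G hG H hH =>
      sup_mem_connNoncrossingOn (Nat.zero_le v) (Finset.mem_Icc.1 hv).2 hG.1 hH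
  · intro G hG
    obtain ⟨v, hv1, hvn, hadj, hmax⟩ := exists_max_adj_zero hn hG
    have hcut : ∀ i j, G.Adj i j → i < v → j ≤ v := by
      intro i j hij hi
      rcases Nat.eq_zero_or_pos i with rfl | h0
      · exact hmax j hij
      · by_contra! hj
        exact hG.2.1 0 i v j h0 hi hj ⟨hadj, hij⟩
    exact ⟨v, Finset.mem_Icc.2 ⟨hv1, hvn⟩, G.onInterval 0 v,
      ⟨onInterval_left_mem_connNoncrossingOn (Nat.zero_le v) hvn hG hcut,
        hadj, by omega⟩,
      G.onInterval v n, onInterval_right_mem_connNoncrossingOn (Nat.zero_le v) hG hcut,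
      onInterval_sup_onInterval hG.1 hcut⟩
  · intro v hv w hw G hG H hH G' hG' H' hH' h
    rw [Finset.mem_Icc] at hv hw
    -- The cut vertex is recovered as the largest neighbour of `0`: since `w ≥ 1`, the right piece
    -- has no edge at `0`.
    have key : ∀ {v w : ℕ} {G H G' H' : SimpleGraph ℕ}, 1 ≤ w →
        G ∈ closedConnNoncrossingOn 0 v →
        G' ∈ closedConnNoncrossingOn 0 w → H' ∈ connNoncrossingOn w n → G ⊔ H = G' ⊔ H' →
        v ≤ w := by
      intro v w G H G' H' hw hG hG' hH' h
      have hadj : (G' ⊔ H').Adj 0 v := h ▸ Or.inl hG.2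
      rcases hadj with h | h
      · exact (hG'.1.1 _ _ h.symm).2
      · have := hH'.1 _ _ h
        omega
    obtain rfl : v = w :=
      le_antisymm (key hw.1 hG hG' hH' h) (key hv.1 hG' hG hH h.symm)
    refine ⟨rfl, ?_, ?_⟩
    · have := congrArg (fun K => K.onInterval 0 v) h
      simpa only [onInterval_sup_left le_rfl hG.1.1 hH.1,
        onInterval_sup_left le_rfl hG'.1.1 hH'.1] using this
    · have := congrArg (fun K => K.onInterval v n) h
      simpa only [onInterval_sup_right le_rfl hG.1.1 hH.1,
        onInterval_sup_right le_rfl hG'.1.1 hH'.1] using this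

/-! ### Deleting the outer edge -/

/-- The closed graphs that become disconnected when the outer edge is deleted. -/
def bridgedConnNoncrossingOn (n : ℕ) : Set (SimpleGraph ℕ) :=
  {G | G ∈ closedConnNoncrossingOn 0 n ∧ G \ edge 0 n ∉ connNoncrossingOn 0 n}

theorem sup_edge_sdiff_edge {H : SimpleGraph ℕ} {n : ℕ} (hH : ¬ H.Adj 0 n) :
    (H ⊔ edge 0 n) \ edge 0 n = H := by
  rw [sup_sdiff_right_self, sdiff_edge H hH]

theorem sdiff_edge_sup_edge {G : SimpleGraph ℕ} {n : ℕ} (hG : G.Adj 0 n) :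
    G \ edge 0 n ⊔ edge 0 n = G := by
  rw [sdiff_sup_cancel]
  exact (edge_le_iff G).2 (Or.inr hG)

theorem noncrossing_sup_edge {H : SimpleGraph ℕ} {n : ℕ}
    (hs : ∀ i j, H.Adj i j → 0 ≤ i ∧ i ≤ n)
    (hn : ∀ a b c d, a < b → b < c → c < d → ¬ (H.Adj a c ∧ H.Adj b d)) :
    ∀ a b c d, a < b → b < c → c < d →
      ¬ ((H ⊔ edge 0 n).Adj a c ∧ (H ⊔ edge 0 n).Adj b d) := by
  rintro a b c d hab hbc hcd ⟨h1, h2⟩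
  rw [sup_adj, edge_adj] at h1 h2
  rcases h2 with h2 | h2
  · rcases h1 with h1 | h1
    · exact hn a b c d hab hbc hcd ⟨h1, h2⟩
    · have := hs _ _ h2.symm
      omega
  · omega

theorem bounded_sup_edge {H : SimpleGraph ℕ} {n : ℕ} (hs : ∀ i j, H.Adj i j → 0 ≤ i ∧ i ≤ n) :
    ∀ i j, (H ⊔ edge 0 n).Adj i j → 0 ≤ i ∧ i ≤ n := by
  intro i j h
  rw [sup_adj, edge_adj] at h
  rcases h with h | h
  · exact hs i j h
  · omega

theorem sup_edge_adj {H : SimpleGraph ℕ} {n : ℕ} (hn : 1 ≤ n) : (H ⊔ edge 0 n).Adj 0 n := by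
  rw [sup_adj, edge_adj]
  exact Or.inr (by omega)

/-- Deleting the outer edge is a bijection from the closed graphs that are not bridged to the
connected graphs lacking that edge. -/
theorem ncard_closed_eq_add {n : ℕ} (hn : 1 ≤ n) :
    2 * (closedConnNoncrossingOn 0 n).ncard =
      (connNoncrossingOn 0 n).ncard + (bridgedConnNoncrossingOn n).ncard := by
  have hfin := finite_connNoncrossingOn (Nat.zero_le n)
  have hfin' := finite_closedConnNoncrossingOn (Nat.zero_le n)
  have h1 := Set.ncard_sdiff_add_ncard_of_subset
    (fun G hG => hG.1 : closedConnNoncrossingOn 0 n ⊆ connNoncrossingOn 0 n) hfin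
  have h2 := Set.ncard_sdiff_add_ncard_of_subset
    (fun G hG => hG.1 : bridgedConnNoncrossingOn n ⊆ closedConnNoncrossingOn 0 n) hfin'
  have h3 : (closedConnNoncrossingOn 0 n \ bridgedConnNoncrossingOn n).ncard =
      (connNoncrossingOn 0 n \ closedConnNoncrossingOn 0 n).ncard := by
    refine Set.ncard_congr (fun G _ => G \ edge 0 n) ?_ ?_ ?_
    · rintro G ⟨hG, hG'⟩
      refine ⟨by_contra fun h => hG' ⟨hG, h⟩, fun h => ?_⟩
      have := h.2
      rw [sdiff_adj, edge_adj] at this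
      exact this.2 (by omega)
    · rintro G G' ⟨hG, -⟩ ⟨hG', -⟩ h
      rw [← sdiff_edge_sup_edge hG.2, h, sdiff_edge_sup_edge hG'.2]
    · rintro H ⟨hH, hH'⟩
      have hadj : ¬ H.Adj 0 n := fun h => hH' ⟨hH, h⟩
      refine ⟨H ⊔ edge 0 n, ⟨⟨⟨bounded_sup_edge hH.1, noncrossing_sup_edge hH.1 hH.2.1, ?_⟩,
        sup_edge_adj hn⟩, fun h => h.2 ?_⟩, sup_edge_sdiff_edge hadj⟩
      · exact fun P h0 hP => hH.2.2 P h0 fun i j h => hP i j (Or.inl h)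
      · rwa [sup_edge_sdiff_edge hadj]
  omega

/-- A bridged graph splits into an initial and a final segment once the outer edge is deleted. -/
theorem exists_cut_of_bridged {G : SimpleGraph ℕ} {n : ℕ} (hG : G ∈ bridgedConnNoncrossingOn n) :
    ∃ m < n, (G \ edge 0 n).onInterval 0 m ∈ connNoncrossingOn 0 m ∧
      (G \ edge 0 n).onInterval (m + 1) n ∈ connNoncrossingOn (m + 1) n ∧
      (G \ edge 0 n).onInterval 0 m ⊔ (G \ edge 0 n).onInterval (m + 1) n = G \ edge 0 n := by
  classical
  obtain ⟨⟨hG, hadj⟩, hdis⟩ := hG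
  set H := G \ edge 0 n with hH
  have hGH : G = H ⊔ edge 0 n := (sdiff_edge_sup_edge hadj).symm
  have hle : ∀ i j, H.Adj i j → G.Adj i j := fun i j h => h.1
  have hs : ∀ i j, H.Adj i j → 0 ≤ i ∧ i ≤ n := fun i j h => hG.1 i j (hle i j h)
  have hn : ∀ a b c d, a < b → b < c → c < d → ¬ (H.Adj a c ∧ H.Adj b d) :=
    fun a b c d hab hbc hcd h => hG.2.1 a b c d hab hbc hcd ⟨hle _ _ h.1, hle _ _ h.2⟩
  have hreach : ∀ i ≤ n, H.Reachable 0 i ∨ H.Reachable n i := by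
    intro i hi
    refine hG.2.2 (fun i => H.Reachable 0 i ∨ H.Reachable n i) (Or.inl (Reachable.refl 0)) ?_ i
      (Nat.zero_le i) hi
    intro i j hij h
    rw [hGH, sup_adj, edge_adj] at hij
    rcases hij with hij | ⟨⟨rfl, rfl⟩ | ⟨rfl, rfl⟩, -⟩
    · exact h.imp (fun h => h.trans hij.reachable) (fun h => h.trans hij.reachable)
    · exact Or.inr (Reachable.refl _)
    · exact Or.inl (Reachable.refl _)
  have hnot : ¬ H.Reachable 0 n := by
    intro h0n
    refine hdis ⟨hs, hn, fun P h0 hP i _ hi => ?_⟩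
    have : H.Reachable 0 i := (hreach i hi).elim id h0n.trans
    exact reachable_iff_forall_closed.1 this P h0 hP
  have hbd : ∀ i ≤ n, H.Reachable 0 i → i ≤ Nat.findGreatest (H.Reachable 0) n :=
    fun i hi h => Nat.le_findGreatest hi h
  have hm : H.Reachable 0 (Nat.findGreatest (H.Reachable 0) n) :=
    Nat.findGreatest_spec (P := H.Reachable 0) (Nat.zero_le n) (Reachable.refl 0)
  have hmn : Nat.findGreatest (H.Reachable 0) n < n :=
    lt_of_le_of_ne (Nat.findGreatest_le n) fun h => hnot (h ▸ hm)
  generalize Nat.findGreatest (H.Reachable 0) n = m at hbd hm hmn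
  -- Here `m` is the last vertex in the component of `0`. If an edge `ij` had `i ≤ m < j`, then `i`
  -- would lie outside that component, and a path from `0` to `m` would have to jump over `i` by an
  -- edge crossing `ij`.
  have hcut : ∀ i j, H.Adj i j → i ≤ m → j ≤ m := by
    intro i j hij him
    by_contra! hj
    have hjn := (hs _ _ hij.symm).2
    have hi0 : ¬ H.Reachable 0 i := fun h => by
      have := hbd j hjn (h.trans hij.reachable)
      omega
    have hclosed := reachable_iff_forall_closed.1 hm (fun x => H.Reachable 0 x ∧ x < i)
      ⟨Reachable.refl 0, Nat.pos_of_ne_zero (by rintro rfl; exact hi0 (Reachable.refl _))⟩ ?_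
    · have := hclosed.2
      omega
    · rintro p q hpq ⟨hp, hpi⟩
      have hq := hp.trans hpq.reachable
      refine ⟨hq, ?_⟩
      by_contra! hqi
      have hne : q ≠ i := fun h => hi0 (h ▸ hq)
      have := hbd q (hs _ _ hpq.symm).2 hq
      exact hn p i q j hpi (by omega) (by omega) ⟨hpq, hij⟩
  have hcut' : ∀ i j, H.Adj i j → m < i → m < j := fun i j hij hi => by
    have := hcut _ _ hij.symm
    omega
  refine ⟨m, hmn, ⟨fun i j h => h.2.1,
    fun a b c d hab hbc hcd h => hn a b c d hab hbc hcd ⟨h.1.1, h.2.1⟩, ?_⟩,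
    ⟨fun i j h => h.2.1,
    fun a b c d hab hbc hcd h => hn a b c d hab hbc hcd ⟨h.1.1, h.2.1⟩, ?_⟩, ?_⟩
  · intro P h0 hP i _ hi
    have hr : H.Reachable 0 i := by
      refine (hreach i (by omega)).resolve_right fun h => ?_
      have := reachable_iff_forall_closed.1 h (fun x => m < x) hmn hcut'
      omega
    refine (reachable_iff_forall_closed.1 hr (fun x => P x ∧ x ≤ m) ⟨h0, Nat.zero_le m⟩ ?_).1
    rintro i j hij ⟨hi, him⟩
    have := hcut _ _ hij him
    exact ⟨hP i j ⟨hij, by omega⟩ hi, this⟩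
  · have hrn : ∀ i, m < i → i ≤ n → H.Reachable n i := fun i hi hin => by
      refine (hreach i hin).resolve_left fun h => ?_
      have := hbd i hin h
      omega
    intro P h0 hP i h1 h2
    have hr : H.Reachable (m + 1) i := (hrn (m + 1) (by omega) hmn).symm.trans (hrn i h1 h2)
    refine (reachable_iff_forall_closed.1 hr (fun x => P x ∧ m < x) ⟨h0, by omega⟩ ?_).1
    rintro i j hij ⟨hi, him⟩
    have := hcut' _ _ hij him
    have := (hs _ _ hij).2
    have := (hs _ _ hij.symm).2
    exact ⟨hP i j ⟨hij, by omega, by omega⟩ hi, by omega⟩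
  · ext i j
    rw [sup_adj, onInterval_adj, onInterval_adj]
    constructor
    · rintro (h | h) <;> exact h.1
    · intro h
      have := hs _ _ h
      have := hs _ _ h.symm
      have := hcut _ _ h
      have := hcut' _ _ h
      by_cases him : i ≤ m
      · exact Or.inl ⟨h, by omega⟩
      · exact Or.inr ⟨h, by omega⟩

theorem sup_sup_edge_mem_bridged {G H : SimpleGraph ℕ} {m n : ℕ} (hm : m < n)
    (hG : G ∈ connNoncrossingOn 0 m) (hH : H ∈ connNoncrossingOn (m + 1) n) :
    G ⊔ H ⊔ edge 0 n ∈ bridgedConnNoncrossingOn n ∧ ¬ (G ⊔ H).Adj 0 n := by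
  have hadj : ¬ (G ⊔ H).Adj 0 n := by
    rintro (h | h)
    · have := hG.1 _ _ h.symm
      omega
    · have := hH.1 _ _ h
      omega
  have hs : ∀ i j, (G ⊔ H).Adj i j → 0 ≤ i ∧ i ≤ n := by
    rintro i j (h | h)
    · have := hG.1 _ _ h
      omega
    · have := hH.1 _ _ h
      omega
  refine ⟨⟨⟨⟨bounded_sup_edge hs,
    noncrossing_sup_edge hs (noncrossing_sup (Nat.le_succ m) hG.1 hH.1 hG.2.1 hH.2.1), ?_⟩,
    sup_edge_adj (by omega)⟩, ?_⟩, hadj⟩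
  · intro P h0 hP i h1 h2
    rcases Nat.lt_or_ge m i with hi | hi
    · have hPn : P n := hP 0 n (sup_edge_adj (by omega)) h0
      -- The outer edge gives `P` at `n`, whereas connectedness of `H` is based at `m + 1`; the
      -- biconditional carries `P` back from `n`.
      have hall := hH.2.2 (fun x => P x ↔ P (m + 1)) Iff.rfl fun i j h hi => by
        rw [← hi]
        exact ⟨hP _ _ (Or.inl (Or.inr h.symm)), hP _ _ (Or.inl (Or.inr h))⟩
      exact (hall i hi h2).2 ((hall n hm le_rfl).1 hPn)
    · exact hG.2.2 P h0 (fun i j h => hP i j (Or.inl (Or.inl h))) i h1 hi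
  · rw [sup_edge_sdiff_edge hadj]
    intro h
    have := h.2.2 (fun x => x ≤ m) (Nat.zero_le m) ?_ n (Nat.zero_le n) le_rfl
    · omega
    · rintro i j (h | h) hi
      · exact (hG.1 _ _ h.symm).2
      · have := hH.1 _ _ h
        omega

theorem ncard_bridgedConnNoncrossingOn (n : ℕ) :
    (bridgedConnNoncrossingOn n).ncard = ∑ m ∈ Finset.range n,
      (connNoncrossingOn 0 m).ncard * (connNoncrossingOn (m + 1) n).ncard := by
  refine Set.ncard_eq_sum_ncard_mul_ncard (fun G H => G ⊔ H ⊔ edge 0 n) ?_ ?_ ?_ ?_ ?_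
  · exact fun m _ => finite_connNoncrossingOn (Nat.zero_le m)
  · exact fun m hm => finite_connNoncrossingOn (Finset.mem_range.1 hm)
  · exact fun m hm G hG H hH => (sup_sup_edge_mem_bridged (Finset.mem_range.1 hm) hG hH).1
  · intro G hG
    obtain ⟨m, hm, h1, h2, h3⟩ := exists_cut_of_bridged hG
    refine ⟨m, Finset.mem_range.2 hm, _, h1, _, h2, ?_⟩
    rw [h3, sdiff_edge_sup_edge hG.1.2]
  · intro m hm m' hm' G hG H hH G' hG' H' hH' h
    rw [Finset.mem_range] at hm hm'
    have hE : G ⊔ H = G' ⊔ H' := by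
      rw [← sup_edge_sdiff_edge (sup_sup_edge_mem_bridged hm hG hH).2, h,
        sup_edge_sdiff_edge (sup_sup_edge_mem_bridged hm' hG' hH').2]
    -- The cut is determined by connectedness of `G`: its edges cannot leave `[0, m']`, so neither
    -- can its last vertex `m`.
    have key : ∀ {m m' : ℕ} {G H G' H' : SimpleGraph ℕ}, G ∈ connNoncrossingOn 0 m →
        G' ∈ connNoncrossingOn 0 m' → H' ∈ connNoncrossingOn (m' + 1) n → G ⊔ H = G' ⊔ H' →
        m ≤ m' := by
      intro m m' G H G' H' hG hG' hH' h
      refine hG.2.2 (fun x => x ≤ m') (Nat.zero_le m') ?_ m (Nat.zero_le m) le_rfl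
      intro i j hij hi
      have hadj : (G' ⊔ H').Adj i j := h ▸ Or.inl hij
      rcases hadj with h | h
      · exact (hG'.1 _ _ h.symm).2
      · have := hH'.1 _ _ h
        omega
    obtain rfl : m = m' := le_antisymm (key hG hG' hH' hE) (key hG' hG hH hE.symm)
    refine ⟨rfl, ?_, ?_⟩
    · rw [← onInterval_sup_left (Nat.le_succ m) hG.1 hH.1, hE,
        onInterval_sup_left (Nat.le_succ m) hG'.1 hH'.1]
    · rw [← onInterval_sup_right (Nat.le_succ m) hG.1 hH.1, hE,
        onInterval_sup_right (Nat.le_succ m) hG'.1 hH'.1]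


/-! ### Recurrences and the cubic equation -/

open PowerSeries

theorem numConnNoncrossing_one : numConnNoncrossing 1 = 1 := by
  rw [numConnNoncrossing, Nat.card_eq_one_iff_unique]
  refine ⟨⟨fun a b => Subtype.ext (Subsingleton.elim _ _)⟩, ⟨⊥, ?_, ?_⟩⟩
  · exact Connected.of_subsingleton
  · intro a b c d h
    omega

/-- The number of connected noncrossing graphs on `{0, …, n}` containing the edge `{0, n}`. -/
noncomputable def numClosedConnNoncrossing (n : ℕ) : ℕ := (closedConnNoncrossingOn 0 n).ncard

theorem numClosedConnNoncrossing_zero : numClosedConnNoncrossing 0 = 0 := by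
  rw [numClosedConnNoncrossing, Set.ncard_eq_zero (finite_closedConnNoncrossingOn le_rfl)]
  exact Set.eq_empty_of_forall_notMem fun G hG => G.loopless.irrefl _ hG.2

theorem numConnNoncrossing_recurrence (n : ℕ) :
    numConnNoncrossing (n + 2) = ∑ p ∈ Finset.HasAntidiagonal.antidiagonal (n + 1),
      numClosedConnNoncrossing p.1 * numConnNoncrossing (p.2 + 1) := by
  have h := ncard_connNoncrossingOn_eq_sum (Nat.le_add_left 1 n)
  have h0 := ncard_connNoncrossingOn 0 (n + 1)
  rw [Nat.zero_add] at h0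
  rw [h0] at h
  -- The antidiagonal has an extra term at `0`, which vanishes because a single vertex carries no
  -- outer edge.
  rw [h, Finset.Nat.sum_antidiagonal_eq_sum_range_succ_mk, Finset.sum_range_succ',
    numClosedConnNoncrossing_zero, Nat.zero_mul, Finset.range_eq_Ico,
    Finset.sum_Ico_add' (fun k => numClosedConnNoncrossing k * numConnNoncrossing (n + 1 - k + 1)),
    add_zero, show Finset.Icc 1 (n + 1) = Finset.Ico (0 + 1) (n + 1 + 1) from rfl]
  refine Finset.sum_congr rfl fun v hv => ?_
  have hv := Finset.mem_Ico.1 hv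
  have h1 := ncard_connNoncrossingOn v (n + 1 - v)
  rw [Nat.add_sub_cancel' (by omega)] at h1
  rw [h1]
  rfl

theorem two_mul_numClosedConnNoncrossing (n : ℕ) :
    2 * numClosedConnNoncrossing (n + 1) = numConnNoncrossing (n + 2) +
      ∑ p ∈ Finset.HasAntidiagonal.antidiagonal n,
        numConnNoncrossing (p.1 + 1) * numConnNoncrossing (p.2 + 1) := by
  have h0 := ncard_connNoncrossingOn 0 (n + 1)
  rw [Nat.zero_add] at h0
  rw [numClosedConnNoncrossing, ncard_closed_eq_add (Nat.le_add_left 1 n), h0,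
    ncard_bridgedConnNoncrossingOn, Finset.Nat.sum_antidiagonal_eq_sum_range_succ_mk]
  congr 1
  refine Finset.sum_congr rfl fun m hm => ?_
  have hm := Finset.mem_range.1 hm
  have h1 := ncard_connNoncrossingOn 0 m
  have h2 := ncard_connNoncrossingOn (m + 1) (n - m)
  rw [Nat.zero_add] at h1
  rw [show m + 1 + (n - m) = n + 1 by omega] at h2
  rw [h1, h2]

/-- The algebraic equation satisfied by the generating function. -/
theorem connNoncrossingSeries_cubic :
    connNoncrossingSeries ^ 3 + connNoncrossingSeries ^ 2 - 3 * X * connNoncrossingSeries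
      + 2 * X ^ 2 = 0 := by
  set D : PowerSeries ℤ := mk fun n => (numConnNoncrossing (n + 1) : ℤ) with hD
  set A : PowerSeries ℤ := mk fun n => (numClosedConnNoncrossing n : ℤ) with hA
  have hCD : connNoncrossingSeries = X * D := by
    ext n
    cases n with
    | zero => simp [connNoncrossingSeries]
    | succ n => simp [connNoncrossingSeries, hD, coeff_succ_X_mul]
  have h1 : D = 1 + A * D := by
    ext n
    cases n with
    | zero =>
      simp [hD, hA, numConnNoncrossing_one, numClosedConnNoncrossing_zero]
    | succ n =>
      rw [map_add, coeff_mul, hD, coeff_mk, numConnNoncrossing_recurrence]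
      simp [hA, coeff_one]
  have h2 : 2 * A = D - 1 + X * (D * D) := by
    ext n
    rw [two_mul, map_add, map_add, map_sub, ← two_mul]
    cases n with
    | zero =>
      simp [hD, hA, numConnNoncrossing_one, numClosedConnNoncrossing_zero]
    | succ n =>
      have := two_mul_numClosedConnNoncrossing n
      rw [coeff_succ_X_mul, coeff_mul]
      simp only [hD, hA, coeff_mk, coeff_one, Nat.succ_ne_zero, if_false, sub_zero]
      exact_mod_cast this
  rw [hCD]
  linear_combination (-X ^ 2 * D) * h2 - 2 * X ^ 2 * h1

/-! ### Reduction modulo 3 -/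

/-- Reduction of an integer power series modulo `3`. -/
noncomputable def redThree : PowerSeries ℤ →+* PowerSeries (ZMod 3) :=
  PowerSeries.map (Int.castRingHom (ZMod 3))

theorem powerSeriesModEq_three_iff {A B : PowerSeries ℤ} :
    PowerSeriesModEq 3 A B ↔ redThree A = redThree B := by
  rw [PowerSeries.ext_iff]
  refine forall_congr' fun n => ?_
  rw [redThree, coeff_map, coeff_map]
  exact (ZMod.intCast_eq_intCast_iff _ _ 3).symm

/-- Over `ZMod 3`, cubing is the substitution `x ↦ x ^ 3`, which shifts the exponents `3 ^ m` and
loses only the term `x`. -/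
theorem redThree_powThreeSeries_cube :
    redThree powThreeSeries ^ 3 = redThree powThreeSeries - X := by
  have hfrob : redThree powThreeSeries ^ 3 =
      PowerSeries.expand 3 three_ne_zero (redThree powThreeSeries) := by
    have := MvPowerSeries.map_frobenius_expand (p := 3) three_ne_zero
      (f := redThree powThreeSeries)
    rw [← this, ZMod.frobenius_zmod, MvPowerSeries.map_id]
    rfl
  rw [hfrob]
  ext n
  rw [coeff_expand, map_sub, coeff_X]
  simp only [redThree, powThreeSeries, coeff_map, coeff_mk]
  by_cases h3 : 3 ∣ n
  · obtain ⟨m, rfl⟩ := h3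
    have h : (∃ k, 3 * m = 3 ^ k) ↔ ∃ k, m = 3 ^ k := by
      constructor
      · rintro ⟨k, hk⟩
        cases k with
        | zero => omega
        | succ k => exact ⟨k, by rw [pow_succ] at hk; omega⟩
      · rintro ⟨k, rfl⟩
        exact ⟨k + 1, by rw [pow_succ]; omega⟩
    have h1 : 3 * m ≠ 1 := by omega
    rw [if_pos (Dvd.intro m rfl), Nat.mul_div_cancel_left m (by norm_num), if_neg h1, sub_zero]
    by_cases hm : ∃ k, m = 3 ^ k
    · rw [if_pos hm, if_pos (h.2 hm)]
    · rw [if_neg hm, if_neg (mt h.1 hm)]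
  · by_cases h1 : n = 1
    · subst h1
      have : ∃ k, 1 = 3 ^ k := ⟨0, rfl⟩
      simp [this]
    · have : ¬ ∃ k, n = 3 ^ k := by
        rintro ⟨k, rfl⟩
        cases k with
        | zero => exact h1 rfl
        | succ k => exact h3 (dvd_pow_self 3 (Nat.succ_ne_zero k))
      simp [h3, h1, this]

theorem connNoncrossingSeries_modEq :
    PowerSeriesModEq 3 connNoncrossingSeries (powThreeSeries + powThreeSeries ^ 2) := by
  rw [powerSeriesModEq_three_iff, map_add, map_pow]
  have hC := congrArg redThree connNoncrossingSeries_cubic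
  have hX : redThree X = X := by simp [redThree]
  have h3 : (3 : PowerSeries (ZMod 3)) = 0 := by
    rw [← map_ofNat (PowerSeries.C (R := ZMod 3)) 3, show (OfNat.ofNat 3 : ZMod 3) = 0 from rfl,
      map_zero]
  simp only [map_add, map_sub, map_mul, map_pow, map_ofNat, hX, map_zero] at hC
  have hF := redThree_powThreeSeries_cube
  have hC1 : coeff 1 (redThree connNoncrossingSeries) = 1 := by
    simp [redThree, connNoncrossingSeries, numConnNoncrossing_one]
  have hC0 : constantCoeff (redThree connNoncrossingSeries) = 0 := by
    rw [← coeff_zero_eq_constantCoeff_apply]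
    simp [redThree, connNoncrossingSeries]
  have hF1 : coeff 1 (redThree powThreeSeries) = 1 := by
    have : ∃ k, 1 = 3 ^ k := ⟨0, rfl⟩
    simp [redThree, powThreeSeries, this]
  have hF0 : constantCoeff (redThree powThreeSeries) = 0 := by
    rw [← coeff_zero_eq_constantCoeff_apply]
    simp [redThree, powThreeSeries, (pow_ne_zero _ three_ne_zero).symm]
  generalize redThree connNoncrossingSeries = c at *
  generalize redThree powThreeSeries = f at *
  obtain ⟨c, rfl⟩ := X_dvd_iff.2 hC0
  obtain ⟨f, rfl⟩ := X_dvd_iff.2 hF0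
  have hc : constantCoeff c = 1 := by simpa [coeff_succ_X_mul] using hC1
  have hf : constantCoeff f = 1 := by simpa [coeff_succ_X_mul] using hF1
  -- With `Y = C` and `Z = F + F ^ 2`, this factors `(Y ^ 3 + Y ^ 2) - (Z ^ 3 + Z ^ 2)`. Modulo 3,
  -- `Z ^ 3 + Z ^ 2 - x ^ 2` equals `(F ^ 3 - F + x) * (F ^ 3 + 2 * F - x)`, hence the multiplier of
  -- `hF`.
  have hmul : (X * c - (X * f + (X * f) ^ 2)) * (X * (X * (c ^ 2 + c * (f + X * f ^ 2) +
      (f + X * f ^ 2) ^ 2) + c + (f + X * f ^ 2))) = 0 := by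
    linear_combination hC + (X * (X * c) - X ^ 2 -
      ((X * f) ^ 2 - X * f * X + (X * f) ^ 3 + (X * f) ^ 4 + (X * f) ^ 5)) * h3 - (2 * (X * f) + (X * f) ^ 3 - X) * hF
  rcases mul_eq_zero.1 hmul with h | h
  · exact sub_eq_zero.1 h
  · exfalso
    have h := (mul_eq_zero.1 h).resolve_left X_ne_zero
    -- The remaining cofactor has constant term `1 + 1`, nonzero in `ZMod 3`.
    have := congrArg constantCoeff h
    simp [hc, hf] at this
    revert this
    decide

/-! ### Coefficients of `F` and `F ^ 2` -/

/-- The larger exponent `b` is determined because the sum is at most `2 * 3 ^ b < 3 ^ (b + 1)`. -/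
theorem eq_of_three_pow_add_eq {a b i j : ℕ} (h : 3 ^ a + 3 ^ b = 3 ^ i + 3 ^ j) :
    (a = i ∧ b = j) ∨ (a = j ∧ b = i) := by
  have key : ∀ {a b i j : ℕ}, a ≤ b → i ≤ j → 3 ^ a + 3 ^ b = 3 ^ i + 3 ^ j → j ≤ b := by
    intro a b i j hab hij h
    by_contra! hlt
    have h1 : 3 ^ a ≤ 3 ^ b := Nat.pow_le_pow_right (by norm_num) hab
    have h2 : 3 ^ (b + 1) ≤ 3 ^ j := Nat.pow_le_pow_right (by norm_num) hlt
    have h3 : 0 < 3 ^ b := by positivity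
    have h4 : 0 < 3 ^ i := by positivity
    rw [pow_succ] at h2
    omega
  have key' : ∀ {a b i j : ℕ}, a ≤ b → i ≤ j → 3 ^ a + 3 ^ b = 3 ^ i + 3 ^ j → a = i ∧ b = j := by
    intro a b i j hab hij h
    obtain rfl : b = j := le_antisymm (key hij hab h.symm) (key hab hij h)
    exact ⟨Nat.pow_right_injective (Nat.le_succ 2) (Nat.add_right_cancel h), rfl⟩
  rcases le_total a b with hab | hab <;> rcases le_total i j with hij | hij
  · exact Or.inl (key' hab hij h)
  · exact Or.inr (key' hab hij (by omega))
  · exact Or.inr (key' hab hij (by omega)).symm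
  · exact Or.inl (key' hab hij (by omega)).symm

theorem odd_three_pow (k : ℕ) : 3 ^ k % 2 = 1 := Nat.odd_iff.1 (Odd.pow (by decide))

open Classical in
theorem coeff_powThreeSeries_sq (n : ℕ) :
    coeff n (powThreeSeries ^ 2) = (((Finset.HasAntidiagonal.antidiagonal n).filter fun p =>
      (∃ i, p.1 = 3 ^ i) ∧ ∃ j, p.2 = 3 ^ j).card : ℤ) := by
  rw [sq, coeff_mul, Finset.card_filter]
  push_cast
  refine Finset.sum_congr rfl fun p _ => ?_
  simp only [powThreeSeries, coeff_mk, ite_and, mul_ite, mul_one, mul_zero]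
  split_ifs <;> rfl

theorem coeff_powThreeSeries_sq_eq_zero {n : ℕ} (h : ∀ i j, n ≠ 3 ^ i + 3 ^ j) :
    coeff n (powThreeSeries ^ 2) = 0 := by
  classical
  rw [coeff_powThreeSeries_sq, Nat.cast_eq_zero, Finset.card_eq_zero,
    Finset.filter_eq_empty_iff]
  rintro ⟨p, q⟩ hp ⟨⟨i, hi⟩, ⟨j, hj⟩⟩
  simp only [Finset.HasAntidiagonal.mem_antidiagonal] at hp hi hj
  exact h i j (by rw [← hp, hi, hj])

theorem coeff_powThreeSeries_sq_add (i j : ℕ) :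
    coeff (3 ^ i + 3 ^ j) (powThreeSeries ^ 2) = if i = j then 1 else 2 := by
  classical
  have hset : ((Finset.HasAntidiagonal.antidiagonal (3 ^ i + 3 ^ j)).filter fun p =>
      (∃ i, p.1 = 3 ^ i) ∧ ∃ j, p.2 = 3 ^ j) = {(3 ^ i, 3 ^ j), (3 ^ j, 3 ^ i)} := by
    ext ⟨p, q⟩
    simp only [Finset.mem_filter, Finset.HasAntidiagonal.mem_antidiagonal, Finset.mem_insert,
      Finset.mem_singleton, Prod.mk.injEq]
    constructor
    · rintro ⟨h, ⟨a, rfl⟩, ⟨b, rfl⟩⟩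
      rcases eq_of_three_pow_add_eq h with ⟨rfl, rfl⟩ | ⟨rfl, rfl⟩ <;> simp
    · rintro (⟨rfl, rfl⟩ | ⟨rfl, rfl⟩)
      · exact ⟨rfl, ⟨i, rfl⟩, ⟨j, rfl⟩⟩
      · exact ⟨Nat.add_comm _ _, ⟨j, rfl⟩, ⟨i, rfl⟩⟩
  rw [coeff_powThreeSeries_sq, hset]
  split_ifs with h
  · subst h
    simp
  · rw [Finset.card_pair]
    · rfl
    · intro h'
      exact h (Nat.pow_right_injective (Nat.le_succ 2) (congrArg Prod.fst h'))

theorem coeff_powThreeSeries_three_pow (k : ℕ) : coeff (3 ^ k) powThreeSeries = 1 := by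
  have : ∃ m, 3 ^ k = 3 ^ m := ⟨k, rfl⟩
  rw [powThreeSeries, coeff_mk, if_pos this]

theorem coeff_powThreeSeries_eq_zero {n : ℕ} (h : ∀ k, n ≠ 3 ^ k) :
    coeff n powThreeSeries = 0 := by
  have : ¬ ∃ m, n = 3 ^ m := fun ⟨m, hm⟩ => h m hm
  rw [powThreeSeries, coeff_mk, if_neg this]

/-- Parity separates the two sides, so no coefficient receives contributions from both `F` and `F ^
2`. -/
theorem three_pow_ne_add (k i j : ℕ) : 3 ^ k ≠ 3 ^ i + 3 ^ j := by
  have := odd_three_pow k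
  have := odd_three_pow i
  have := odd_three_pow j
  omega

theorem numConnNoncrossing_modEq {n r : ℕ} (hn : 1 ≤ n)
    (h : coeff n powThreeSeries + coeff n (powThreeSeries ^ 2) = r) :
    numConnNoncrossing n ≡ r [MOD 3] := by
  have := connNoncrossingSeries_modEq n
  rw [map_add, h, connNoncrossingSeries, coeff_mk, if_pos hn] at this
  exact (Int.natCast_modEq_iff).1 this

theorem theorem1 :
    PowerSeriesModEq 3 connNoncrossingSeries (powThreeSeries + powThreeSeries ^ 2) ∧
    ∀ n : ℕ, 1 ≤ n →
      ((∃ k : ℕ, n = 3 ^ k ∨ n = 2 * 3 ^ k) → numConnNoncrossing n ≡ 1 [MOD 3]) ∧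
      ((∃ i j : ℕ, i ≠ j ∧ n = 3 ^ i + 3 ^ j) → numConnNoncrossing n ≡ 2 [MOD 3]) ∧
      (¬ (∃ k : ℕ, n = 3 ^ k ∨ n = 2 * 3 ^ k) → ¬ (∃ i j : ℕ, i ≠ j ∧ n = 3 ^ i + 3 ^ j) →
        numConnNoncrossing n ≡ 0 [MOD 3]) := by
  refine ⟨connNoncrossingSeries_modEq, fun n hn => ⟨?_, ?_, ?_⟩⟩
  · rintro ⟨k, rfl | rfl⟩ <;> refine numConnNoncrossing_modEq hn ?_
    · rw [coeff_powThreeSeries_three_pow, coeff_powThreeSeries_sq_eq_zero (three_pow_ne_add k)]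
      rfl
    · rw [two_mul, coeff_powThreeSeries_sq_add, if_pos rfl,
        coeff_powThreeSeries_eq_zero fun m => (three_pow_ne_add m k k).symm]
      rfl
  · rintro ⟨i, j, hij, rfl⟩
    refine numConnNoncrossing_modEq hn ?_
    rw [coeff_powThreeSeries_sq_add, if_neg hij,
      coeff_powThreeSeries_eq_zero fun m => (three_pow_ne_add m i j).symm]
    rfl
  · intro h1 h2
    refine numConnNoncrossing_modEq hn ?_
    rw [coeff_powThreeSeries_eq_zero fun k hk => h1 ⟨k, Or.inl hk⟩,
      coeff_powThreeSeries_sq_eq_zero]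
    · rfl
    · intro i j h
      rcases eq_or_ne i j with rfl | hij
      · exact h1 ⟨i, Or.inr (by omega)⟩
      · exact h2 ⟨i, j, hij, h⟩
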